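/- There is an absolute constant $c>0$ such that the following holds. For all $L>0$, $\Delta_0>0$, every integer $n\ge 1$ and every $0<\epsilon\le\sqrt{\Delta_0 L}$ there is a dimension $d$ such that for every starting point $x^0\in\mathbb{R}^d$ there are differentiable functions $f_1,\dots,f_n:\mathbb{R}^d\to\mathbb{R}$ for which $f:=\frac1n\sum_{i=1}^n f_i$ is average $L$-smooth, i.e. $$\frac1n\sum_{i=1}^n\|\nabla f_i(x)-\nabla f_i(y)\|^2\le L^2\|x-y\|^2\qquad\text{for all }x,y\in\mathbb{R}^d,$$ $f$ attains its minimum $f^*$ with $f(x^0)-f^*=\Delta_0$, and every (possibly randomized) linear-span first-order algorithm started at $x^0$ that returns a (possibly random) point $\widehat x$ with $\mathbb{E}\|\nabla f(\widehat x)\|\le\epsilon$ computes in expectation at least $$c\left(n+\frac{\Delta_0L\sqrt n}{\epsilon^2}\right)$$ stochastic gradients. Here a linear-span first-order algorithm produces points $x^0,x^1,x^2,\dots$ and chooses indices $i_0,i_1,\dots\in\{1,\dots,n\}$, all possibly random and the indices chosen in any way, so that almost surely, for all $t\ge1$, $$x^t\in\mathrm{Lin}\{x^0,\dots,x^{t-1},\nabla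 f_{i_0}(x^0),\dots,\nabla f_{i_{t-1}}(x^{t-1})\};$$ one stochastic gradient $\nabla f_{i_t}(x^t)$ is computed per iteration, and after a (possibly random) number $\tau$ of stochastic gradients the algorithm returns a point $\widehat x\in\mathrm{Lin}\{x^0,\dots,x^{\tau},\nabla f_{i_0}(x^0),\dots,\nabla f_{i_{\tau-1}}(x^{\tau-1})\}$, for instance one of the points $x^0,\dots,x^\tau$. -/

import Mathlib

open MeasureTheory
open scoped ENNReal

universe u

noncomputable section

/-- The finite-sum objective `f = (1/n) ∑ᵢ fᵢ`. -/
def finiteSum {n d : ℕ} (f : Fin n → EuclideanSpace ℝ (Fin d) → ℝ)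
    (x : EuclideanSpace ℝ (Fin d)) : ℝ :=
  (1 / (n : ℝ)) * ∑ i, f i x

/-- Average `L`-smoothness of a finite sum:
`𝔼ᵢ ‖∇fᵢ(x) - ∇fᵢ(y)‖² ≤ L² ‖x - y‖²` for all `x, y`, with `i` uniform on the `n` indices. -/
def AverageSmooth {n d : ℕ} (L : ℝ) (f : Fin n → EuclideanSpace ℝ (Fin d) → ℝ) : Prop :=
  ∀ x y : EuclideanSpace ℝ (Fin d),
    (1 / (n : ℝ)) * ∑ i, ‖gradient (f i) x - gradient (f i) y‖ ^ 2 ≤ L ^ 2 * ‖x - y‖ ^ 2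

/-- `Lin {x⁰, …, x^{s-1}, ∇f_{i_0}(x⁰), …, ∇f_{i_{t-1}}(x^{t-1})}`. -/
def linSpan {n d : ℕ} (f : Fin n → EuclideanSpace ℝ (Fin d) → ℝ)
    (x : ℕ → EuclideanSpace ℝ (Fin d)) (i : ℕ → Fin n) (s t : ℕ) :
    Submodule ℝ (EuclideanSpace ℝ (Fin d)) :=
  Submodule.span ℝ
    (x '' Set.Iio s ∪ (fun j => gradient (f (i j)) (x j)) '' Set.Iio t)

/-- A run, on the finite sum with components `f`, of a (randomized) linear-span first-order
algorithm started at `x0`, whose randomness lives on `(Ω, μ)`. At iteration `j` one stochastic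
gradient `∇f_{i_j}(x^j)` is computed, so a minibatch is a block of iterations in which the point
does not move. After a (possibly random) number `count` of stochastic gradients the algorithm
returns `output`, any point in the linear span of what it has seen (e.g. an iterate). -/
structure LinearSpanRun {n d : ℕ} (f : Fin n → EuclideanSpace ℝ (Fin d) → ℝ)
    (x0 : EuclideanSpace ℝ (Fin d)) {Ω : Type u} [MeasurableSpace Ω] (μ : Measure Ω) where
  /-- the points `x^t` -/
  point : ℕ → Ω → EuclideanSpace ℝ (Fin d)
  /-- the index `i_t` of the component chosen at iteration `t` -/
  index : ℕ → Ω → Fin n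
  /-- the number of stochastic gradients computed before the algorithm returns -/
  count : Ω → ℕ
  /-- the returned point -/
  output : Ω → EuclideanSpace ℝ (Fin d)
  measurable_point : ∀ t, Measurable (point t)
  measurable_index : ∀ t, Measurable (index t)
  measurable_count : Measurable count
  measurable_output : Measurable output
  start : ∀ᵐ ω ∂μ, point 0 ω = x0
  point_mem : ∀ᵐ ω ∂μ, ∀ t, 1 ≤ t →
    point t ω ∈ linSpan f (fun j => point j ω) (fun j => index j ω) t t
  output_mem : ∀ᵐ ω ∂μ,
    output ω ∈ linSpan f (fun j => point j ω) (fun j => index j ω) (count ω + 1) (count ω)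

end

/-!
The indices may be chosen with full knowledge of the components, so the bound holds along every
sample path: it counts how many coordinates a linear-span run can have reached.

The hard sum lives on `n` blocks of `K` orthonormal coordinates, all orthogonal to `x0`, so that
having `x0` itself in the span does not help. A query of component `j` makes at most one new
coordinate, of block `j`, nonzero. After `t` queries at least `n - t / K` blocks still have a
vanishing last coordinate; if each such block contributes `G ^ 2 / n` to `‖∇f‖ ^ 2`, then
`‖∇f‖ ≥ G (1 - t / (n K))` at the output. This is affine in `t`, hence survives taking expectations,
and `G ≥ √2 ε` forces `n K / 4` queries on average (`exists_hard_finiteSum`).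

Two families of blocks are used, according to the size of `R = Δ₀ L / (2560 √n ε ^ 2)`.

* If `R < 1`, the term `n` dominates. With `K = 1`, quadratics with a common Hessian `L` and linear
  terms along distinct coordinates have `‖∇f(x0)‖ = √(2 L Δ₀) ≥ √2 ε`
  (`hasHardFiniteSum_quadratic`).
* If `R ≥ 1`, each component is a copy, in its own block, of one nonconvex chain of length `K = ⌊R⌋`
  (`hasHardFiniteSum_chain`). Since every component sees only its own block, it may be `√n L`-smooth
  while the average stays `L`-smooth. From the origin to its minimum the chain drops by
  `K - 1 / 2`. Its gradient has a Lipschitz constant independent of `K`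
  (`sum_chainGrad_sub_sq_le`) and is bounded below in norm until the last coordinate is reached
  (`sum_chainGrad_sq_ge`). Scaling gives `G ^ 2` of order
  `Δ₀ L / (√n K)`.
-/

/-! ### Coordinates reached by linear-span runs -/

/-- The number of the first `t` queries that went to the component `i`. -/
def queryCount {n : ℕ} (idx : ℕ → Fin n) (t : ℕ) (i : Fin n) : ℕ :=
  ((Finset.range t).filter fun j => idx j = i).card

lemma queryCount_mono {n : ℕ} (idx : ℕ → Fin n) {s t : ℕ} (h : s ≤ t) (i : Fin n) :
    queryCount idx s i ≤ queryCount idx t i :=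
  Finset.card_le_card (Finset.filter_subset_filter _ (Finset.range_mono h))

lemma queryCount_succ {n : ℕ} (idx : ℕ → Fin n) (t : ℕ) (i : Fin n) :
    queryCount idx (t + 1) i = queryCount idx t i + if i = idx t then 1 else 0 := by
  unfold queryCount
  rw [Finset.range_add_one, Finset.filter_insert]
  by_cases h : idx t = i
  · simp [h]
  · simp [h, Ne.symm h]

lemma sum_queryCount {n : ℕ} (idx : ℕ → Fin n) (t : ℕ) : ∑ i, queryCount idx t i = t := by
  have := Finset.card_eq_sum_card_fiberwise (f := idx) (s := Finset.range t) (t := Finset.univ)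
    (fun _ _ => Finset.mem_coe.2 (Finset.mem_univ _))
  simpa [queryCount] using this.symm

/-- Exhausting a component takes `K` queries, so `t` queries leave at least `n - t / K` components
with fewer than `K` queries. -/
lemma sub_div_le_card_queryCount_lt {n K : ℕ} (hK : 0 < K) (idx : ℕ → Fin n) (t : ℕ) :
    (n : ℝ) - t / K ≤ (Finset.univ.filter fun i => queryCount idx t i < K).card := by
  have h1 : (Finset.univ.filter fun i => ¬ queryCount idx t i < K).card * K ≤ t := by
    calc _ ≤ ∑ i ∈ Finset.univ.filter fun i => ¬ queryCount idx t i < K, queryCount idx t i := by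
          rw [← smul_eq_mul]
          exact Finset.card_nsmul_le_sum _ _ _ fun i hi => by simpa using hi
      _ ≤ ∑ i, queryCount idx t i :=
          Finset.sum_le_sum_of_subset (Finset.filter_subset _ _)
      _ = t := sum_queryCount idx t
  have h2 := Finset.card_filter_add_card_filter_not (s := (Finset.univ : Finset (Fin n)))
    (fun i => queryCount idx t i < K)
  rw [Finset.card_univ, Fintype.card_fin] at h2
  have hK' : (0 : ℝ) < K := by exact_mod_cast hK
  have h3 : ((Finset.univ.filter fun i => ¬ queryCount idx t i < K).card : ℝ) ≤ t / K := by
    rw [le_div_iff₀ hK']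
    exact_mod_cast h1
  have h4 : ((Finset.univ.filter fun i => queryCount idx t i < K).card : ℝ) +
      (Finset.univ.filter fun i => ¬ queryCount idx t i < K).card = n := by exact_mod_cast h2
  linarith

/-- The vectors whose coordinates `⟪e (i, k), v⟫` vanish for all `k ≥ p i`. -/
def progressSubmodule {n K d : ℕ} (e : Fin n × Fin K → EuclideanSpace ℝ (Fin d)) (p : Fin n → ℕ) :
    Submodule ℝ (EuclideanSpace ℝ (Fin d)) where
  carrier := {v | ∀ i k, p i ≤ (k : Fin K).val → inner ℝ (e (i, k)) v = 0}
  add_mem' ha hb i k h := by rw [inner_add_right, ha i k h, hb i k h, add_zero]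
  zero_mem' i k _ := inner_zero_right _
  smul_mem' c v hv i k h := by rw [inner_smul_right, hv i k h, mul_zero]

lemma progressSubmodule_mono {n K d : ℕ} (e : Fin n × Fin K → EuclideanSpace ℝ (Fin d))
    {p q : Fin n → ℕ} (h : p ≤ q) : progressSubmodule e p ≤ progressSubmodule e q :=
  fun _ hv i k hk => hv i k ((h i).trans hk)

lemma linSpan_le_progressSubmodule {n K d : ℕ} (e : Fin n × Fin K → EuclideanSpace ℝ (Fin d))
    (f : Fin n → EuclideanSpace ℝ (Fin d) → ℝ)
    (hf : ∀ p j x, x ∈ progressSubmodule e p →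
      gradient (f j) x ∈ progressSubmodule e fun i => p i + if i = j then 1 else 0)
    (x : ℕ → EuclideanSpace ℝ (Fin d)) (idx : ℕ → Fin n) {s t : ℕ} (hst : s ≤ t + 1)
    (hx : ∀ j < s, x j ∈ progressSubmodule e (queryCount idx j))
    (hx' : ∀ j < t, x j ∈ progressSubmodule e (queryCount idx j)) :
    linSpan f x idx s t ≤ progressSubmodule e (queryCount idx t) := by
  refine Submodule.span_le.2 (Set.union_subset ?_ ?_)
  · rintro _ ⟨j, hj, rfl⟩
    have hj' : j < s := hj
    exact progressSubmodule_mono e (queryCount_mono idx (by omega)) (hx j hj)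
  · rintro _ ⟨j, hj, rfl⟩
    have hj' : j + 1 ≤ t := hj
    refine progressSubmodule_mono e (queryCount_mono idx hj') ?_
    have := hf _ (idx j) _ (hx' j hj)
    have h : queryCount idx (j + 1) = fun i => queryCount idx j i + if i = idx j then 1 else 0 :=
      funext fun i => queryCount_succ idx j i
    rw [h]
    exact this

/-- Each query of `f j` reveals at most one further coordinate of the `j`-th block. -/
lemma point_mem_progressSubmodule {n K d : ℕ} (e : Fin n × Fin K → EuclideanSpace ℝ (Fin d))
    (f : Fin n → EuclideanSpace ℝ (Fin d) → ℝ)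
    (hf : ∀ p j x, x ∈ progressSubmodule e p →
      gradient (f j) x ∈ progressSubmodule e fun i => p i + if i = j then 1 else 0)
    (x : ℕ → EuclideanSpace ℝ (Fin d)) (idx : ℕ → Fin n)
    (h0 : ∀ k, inner ℝ (e k) (x 0) = 0)
    (hx : ∀ t, 1 ≤ t → x t ∈ linSpan f x idx t t) (t : ℕ) :
    x t ∈ progressSubmodule e (queryCount idx t) := by
  induction t using Nat.strong_induction_on with
  | _ t ih =>
    rcases Nat.eq_zero_or_pos t with rfl | ht
    · exact fun i k _ => h0 (i, k)
    · exact linSpan_le_progressSubmodule e f hf x idx (Nat.le_succ t) ih ih (hx t ht)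

/-- A vector `x0` is orthogonal to some orthonormal family of `d` vectors in dimension `d + 1`. -/
lemma exists_orthonormal_orthogonal {ι : Type*} [Fintype ι] {d : ℕ} (hd : Fintype.card ι + 1 = d)
    (x0 : EuclideanSpace ℝ (Fin d)) :
    ∃ e : ι → EuclideanSpace ℝ (Fin d), Orthonormal ℝ e ∧ ∀ k, inner ℝ (e k) x0 = 0 := by
  let V : Submodule ℝ (EuclideanSpace ℝ (Fin d)) := (Submodule.span ℝ {x0})ᗮ
  have h1 : Module.finrank ℝ (Submodule.span ℝ {x0}) ≤ 1 := by
    simpa using finrank_span_le_card (R := ℝ) ({x0} : Set (EuclideanSpace ℝ (Fin d)))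
  have h2 := Submodule.finrank_add_finrank_orthogonal (Submodule.span ℝ {x0})
  rw [finrank_euclideanSpace_fin] at h2
  have h3 : Fintype.card ι ≤ Module.finrank ℝ V := by
    change Fintype.card ι ≤ Module.finrank ℝ (Submodule.span ℝ {x0})ᗮ
    omega
  let b := stdOrthonormalBasis ℝ V
  let g : ι → Fin (Module.finrank ℝ V) := fun i => Fin.castLE h3 (Fintype.equivFin ι i)
  have hg : Function.Injective g :=
    (Fin.castLE_injective h3).comp (Fintype.equivFin ι).injective
  refine ⟨fun i => (b (g i) : EuclideanSpace ℝ (Fin d)), ?_, fun k => ?_⟩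
  · exact (b.orthonormal.comp g hg).comp_linearIsometry V.subtypeₗᵢ
  · exact Submodule.inner_left_of_mem_orthogonal (Submodule.mem_span_singleton_self x0)
      (b (g k)).2

/-! ### From pathwise bounds to hard finite sums -/

/-- The pathwise bound `‖∇f(output)‖ ≥ G (1 - count / N)`, integrated. -/
lemma le_lintegral_count {Ω : Type u} [MeasurableSpace Ω] (μ : Measure Ω) [IsProbabilityMeasure μ]
    {count : Ω → ℕ} (hc : Measurable count) {N G ε : ℝ} (hN : 0 < N) (hε : 0 < ε)
    (hG : 0 ≤ G) (hGε : 2 * ε ^ 2 ≤ G ^ 2) {X : Ω → ℝ≥0∞}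
    (hX : ∀ᵐ ω ∂μ, ENNReal.ofReal (G * (1 - count ω / N)) ≤ X ω)
    (hε' : ∫⁻ ω, X ω ∂μ ≤ ENNReal.ofReal ε) :
    ENNReal.ofReal (N / 4) ≤ ∫⁻ ω, (count ω : ℝ≥0∞) ∂μ := by
  -- `G ≥ √2 ε`, hence `1 - ε / G ≥ 1 - 1 / √2 ≥ 1 / 4`
  have hG' : 4 * ε ≤ 3 * G := by nlinarith
  have hG0 : 0 < G := by linarith
  have hmeas : Measurable fun ω => (count ω : ℝ≥0∞) := by fun_prop
  by_cases htop : ∫⁻ ω, (count ω : ℝ≥0∞) ∂μ = ∞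
  · simp [htop]
  have key : ENNReal.ofReal G ≤
      ENNReal.ofReal ε + ENNReal.ofReal (G / N) * ∫⁻ ω, (count ω : ℝ≥0∞) ∂μ := by
    calc ENNReal.ofReal G = ∫⁻ _, ENNReal.ofReal G ∂μ := by simp
      _ ≤ ∫⁻ ω, X ω + ENNReal.ofReal (G / N) * count ω ∂μ := by
          refine lintegral_mono_ae ?_
          filter_upwards [hX] with ω hω
          refine le_trans ?_ (add_le_add_left hω _)
          rw [← ENNReal.ofReal_natCast, ← ENNReal.ofReal_mul (by positivity)]
          refine le_trans (ENNReal.ofReal_le_ofReal ?_) ENNReal.ofReal_add_le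
          apply le_of_eq
          field_simp
          ring
      _ = ∫⁻ ω, X ω ∂μ + ENNReal.ofReal (G / N) * ∫⁻ ω, (count ω : ℝ≥0∞) ∂μ := by
          rw [lintegral_add_right _ (hmeas.const_mul _), lintegral_const_mul _ hmeas]
      _ ≤ _ := by gcongr
  set I := ∫⁻ ω, (count ω : ℝ≥0∞) ∂μ with hI
  rw [← ENNReal.ofReal_toReal htop] at key ⊢
  rw [← ENNReal.ofReal_mul (by positivity), ← ENNReal.ofReal_add hε.le (by positivity),
    ENNReal.ofReal_le_ofReal_iff (by positivity)] at key
  apply ENNReal.ofReal_le_ofReal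
  have h5 : G / N * I.toReal * N = G * I.toReal := by field_simp
  have h6 : G * N ≤ ε * N + G * I.toReal := by nlinarith
  nlinarith [mul_le_mul_of_nonneg_right hG' hN.le]

/-- Some average `L`-smooth sum of `n` components on `ℝ ^ d`, with optimality gap `Δ₀` at `x0`,
forces every linear-span algorithm started at `x0` to compute at least `N` stochastic gradients in
expectation before it returns a point of expected gradient norm at most `ε`. -/
def HasHardFiniteSum (n d : ℕ) (L Δ₀ ε N : ℝ) (x0 : EuclideanSpace ℝ (Fin d)) : Prop :=
  ∃ f : Fin n → EuclideanSpace ℝ (Fin d) → ℝ,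
    (∀ i, Differentiable ℝ (f i)) ∧
    AverageSmooth L f ∧
    (∃ xstar, (∀ x, finiteSum f xstar ≤ finiteSum f x) ∧
      finiteSum f x0 - finiteSum f xstar = Δ₀) ∧
    ∀ (Ω : Type u) [MeasurableSpace Ω] (μ : Measure Ω) [IsProbabilityMeasure μ]
      (A : LinearSpanRun f x0 μ),
      ∫⁻ ω, ‖gradient (finiteSum f) (A.output ω)‖ₑ ∂μ ≤ ENNReal.ofReal ε →
      ENNReal.ofReal N ≤ ∫⁻ ω, (A.count ω : ℝ≥0∞) ∂μ

/-- Hard finite sums from coordinate functions. The coordinates form `n` blocks of length `K`, and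
`c i u` is the gradient of `F i` at `u`. If one query of the `j`-th component extends the support
by at most one coordinate, of the `j`-th block (`hchain`), and every block whose last coordinate
vanishes contributes `G ^ 2 / n` to the squared gradient norm of the mean (`hlarge`), then composing
with orthonormal coordinates orthogonal to `x0` gives a finite sum needing `n * K / 4` queries. -/
theorem exists_hard_finiteSum {n K : ℕ} (hn : 0 < n) (hK : 0 < K) {L Δ₀ ε G : ℝ} (hε : 0 < ε)
    (hG : 0 ≤ G) (hGε : 2 * ε ^ 2 ≤ G ^ 2)
    (F : Fin n → (Fin n × Fin K → ℝ) → ℝ)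
    (c : Fin n → (Fin n × Fin K → ℝ) → Fin n × Fin K → ℝ)
    (hF : ∀ i u, HasFDerivAt (F i)
      (∑ k, c i u k • (ContinuousLinearMap.proj k : (Fin n × Fin K → ℝ) →L[ℝ] ℝ)) u)
    (hsmooth : ∀ u v, (1 / (n : ℝ)) * ∑ i, ∑ k, (c i u k - c i v k) ^ 2 ≤
      L ^ 2 * ∑ k, (u k - v k) ^ 2)
    (hmin : ∃ v, (∀ u, ∑ i, F i v ≤ ∑ i, F i u) ∧
      (1 / (n : ℝ)) * ∑ i, F i 0 - (1 / (n : ℝ)) * ∑ i, F i v = Δ₀)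
    (hchain : ∀ (p : Fin n → ℕ) (u : Fin n × Fin K → ℝ), (∀ i k, p i ≤ k.val → u (i, k) = 0) →
      ∀ j i k, (p i + if i = j then 1 else 0) ≤ k.val → c j u (i, k) = 0)
    (hlarge : ∀ (S : Finset (Fin n)) (u : Fin n × Fin K → ℝ),
      (∀ i ∈ S, u (i, ⟨K - 1, Nat.sub_lt hK one_pos⟩) = 0) →
      G ^ 2 / n * S.card ≤ ∑ k, ((1 / (n : ℝ)) * ∑ i, c i u k) ^ 2)
    (x0 : EuclideanSpace ℝ (Fin (n * K + 1))) :
    HasHardFiniteSum.{u} n (n * K + 1) L Δ₀ ε (n * K / 4) x0 := by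
  obtain ⟨e, he, he0⟩ := exists_orthonormal_orthogonal (ι := Fin n × Fin K) (by simp) x0
  let T : EuclideanSpace ℝ (Fin (n * K + 1)) →L[ℝ] (Fin n × Fin K → ℝ) :=
    ContinuousLinearMap.pi fun k => innerSL ℝ (e k)
  have hT : ∀ x k, T x k = inner ℝ (e k) x := fun x k => rfl
  have hT0 : T x0 = 0 := funext fun k => he0 k
  have hTe : ∀ (a : Fin n × Fin K → ℝ) k, inner ℝ (e k) (∑ l, a l • e l) = a k := fun a k => by
    simpa using he.inner_right_fintype a k
  have hnorm : ∀ a : Fin n × Fin K → ℝ, ‖∑ k, a k • e k‖ ^ 2 = ∑ k, a k ^ 2 := fun a => by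
    rw [← real_inner_self_eq_norm_sq, he.inner_sum]
    simp [sq]
  have hgrad : ∀ i x, HasGradientAt (fun x => F i (T x)) (∑ k, c i (T x) k • e k) x := by
    intro i x
    rw [hasGradientAt_iff_hasFDerivAt]
    refine ((hF i (T x)).comp x T.hasFDerivAt).congr_fderiv ?_
    ext y
    simp [hT]
  have hgrad' : ∀ i x, gradient (fun x => F i (T x)) x = ∑ k, c i (T x) k • e k :=
    fun i x => (hgrad i x).gradient
  have hgradsum : ∀ x, gradient (finiteSum fun i x => F i (T x)) x =
      ∑ k, ((1 / (n : ℝ)) * ∑ i, c i (T x) k) • e k := by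
    intro x
    apply HasGradientAt.gradient
    rw [hasGradientAt_iff_hasFDerivAt]
    have h := (HasFDerivAt.fun_sum (u := Finset.univ) fun i _ =>
      (hasGradientAt_iff_hasFDerivAt.1 (hgrad i x))).const_mul (1 / (n : ℝ))
    refine h.congr_fderiv ?_
    rw [← map_sum, ← LinearIsometryEquiv.map_smul]
    congr 1
    rw [Finset.sum_comm, Finset.smul_sum]
    refine Finset.sum_congr rfl fun k _ => ?_
    rw [← Finset.sum_smul, smul_smul]
  refine ⟨fun i x => F i (T x), fun i x => (hgrad i x).differentiableAt, ?_, ?_, ?_⟩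
  · intro x y
    have h1 : ∀ i, ‖gradient (fun x => F i (T x)) x - gradient (fun x => F i (T x)) y‖ ^ 2 =
        ∑ k, (c i (T x) k - c i (T y) k) ^ 2 := fun i => by
      rw [hgrad', hgrad', ← Finset.sum_sub_distrib, ← hnorm]
      simp_rw [sub_smul]
    simp_rw [h1]
    refine (hsmooth (T x) (T y)).trans ?_
    gcongr
    have h2 := he.sum_inner_products_le (x := x - y) (s := Finset.univ)
    refine le_trans (le_of_eq ?_) h2
    refine Finset.sum_congr rfl fun k _ => ?_
    rw [hT, hT, ← inner_sub_right, Real.norm_eq_abs, sq_abs]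
  · obtain ⟨v, hv, hv'⟩ := hmin
    have hTv : T (∑ k, v k • e k) = v := funext fun k => hTe v k
    refine ⟨∑ k, v k • e k, fun x => ?_, ?_⟩
    · simp only [finiteSum, hTv]
      gcongr 1
      exact hv _
    · simp only [finiteSum, hTv, hT0, hv']
  · intro Ω _ μ _ A hA
    have hn' : (0 : ℝ) < n := by exact_mod_cast hn
    have hK' : (0 : ℝ) < K := by exact_mod_cast hK
    have hprog : ∀ p j x, x ∈ progressSubmodule e p →
        gradient (fun x => F j (T x)) x ∈
          progressSubmodule e fun i => p i + if i = j then 1 else 0 := by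
      intro p j x hx i k hk
      rw [hgrad', hTe]
      exact hchain p (T x) hx j i k hk
    refine le_lintegral_count μ A.measurable_count (by positivity) hε hG hGε ?_ hA
    filter_upwards [A.start, A.point_mem, A.output_mem] with ω h0 hp ho
    have hpt := point_mem_progressSubmodule e _ hprog (fun j => A.point j ω)
      (fun j => A.index j ω) (fun k => by simp only [h0, he0]) hp
    have hout := linSpan_le_progressSubmodule e _ hprog _ _ le_rfl (fun j _ => hpt j)
      (fun j _ => hpt j) ho
    rw [← ofReal_norm]
    apply ENNReal.ofReal_le_ofReal
    set τ := A.count ω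
    have h1 := hlarge (Finset.univ.filter fun i => queryCount (fun j => A.index j ω) τ i < K)
      (T (A.output ω)) (fun i hi => hout i _ (by
        have := (Finset.mem_filter.1 hi).2
        simp only
        omega))
    rw [← hnorm, ← hgradsum] at h1
    have h2 := sub_div_le_card_queryCount_lt hK (fun j => A.index j ω) τ
    have h3 : G ^ 2 * (1 - τ / (n * K)) ≤ ‖gradient (finiteSum fun i x => F i (T x))
        (A.output ω)‖ ^ 2 := by
      refine le_trans ?_ h1
      calc G ^ 2 * (1 - τ / (n * K)) = G ^ 2 / n * (n - τ / K) := by field_simp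
        _ ≤ _ := by gcongr
    rcases le_total (1 - (τ : ℝ) / (n * K)) 0 with h | h
    · exact (mul_nonpos_of_nonneg_of_nonpos hG h).trans (norm_nonneg _)
    · refine abs_le_of_sq_le_sq' ?_ (norm_nonneg _) |>.2
      have h4 : 1 - (τ : ℝ) / (n * K) ≤ 1 := by
        have : 0 ≤ (τ : ℝ) / (n * K) := by positivity
        linarith
      refine le_trans ?_ h3
      rw [mul_pow]
      gcongr
      nlinarith

lemma HasHardFiniteSum.mono {n d : ℕ} {L Δ₀ ε N N' : ℝ} {x0 : EuclideanSpace ℝ (Fin d)}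
    (h : HasHardFiniteSum.{u} n d L Δ₀ ε N x0) (hN : N' ≤ N) :
    HasHardFiniteSum.{u} n d L Δ₀ ε N' x0 := by
  obtain ⟨f, h1, h2, h3, h4⟩ := h
  exact ⟨f, h1, h2, h3, fun Ω _ μ _ A hA =>
    (ENNReal.ofReal_le_ofReal hN).trans (h4 Ω μ A hA)⟩

/-! ### Quadratic components -/

/-- Quadratics sharing their Hessian, with linear terms in distinct coordinates: the gradient at the
start has norm `√(2 L Δ₀)`, the largest possible, and each query cancels a single coordinate
of it. -/
theorem hasHardFiniteSum_quadratic {n : ℕ} (hn : 0 < n) {L Δ₀ ε : ℝ} (hL : 0 < L) (hΔ : 0 < Δ₀)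
    (hε : 0 < ε) (hεΔ : ε ^ 2 ≤ Δ₀ * L) (x0 : EuclideanSpace ℝ (Fin (n * 1 + 1))) :
    HasHardFiniteSum.{u} n (n * 1 + 1) L Δ₀ ε (n / 4) x0 := by
  have hn' : (0 : ℝ) < n := by exact_mod_cast hn
  set b := Real.sqrt (2 * n * L * Δ₀) with hb
  have hb2 : b ^ 2 = 2 * n * L * Δ₀ := Real.sq_sqrt (by positivity)
  have hG2 : Real.sqrt (2 * L * Δ₀) ^ 2 = 2 * L * Δ₀ := Real.sq_sqrt (by positivity)
  have hsum : ∀ u : Fin n × Fin 1 → ℝ,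
      ∑ i, (L / 2 * ∑ k, u k ^ 2 - b * u (i, 0)) =
        ∑ i, (n * L / 2 * u (i, 0) ^ 2 - b * u (i, 0)) := by
    intro u
    rw [Finset.sum_sub_distrib, Finset.sum_sub_distrib, Finset.sum_const, Fintype.sum_prod_type,
      ← Finset.mul_sum, ← Finset.mul_sum]
    simp only [Finset.univ_unique, Fin.default_eq_zero, Finset.sum_singleton, Finset.card_univ,
      Fintype.card_fin, nsmul_eq_mul]
    ring
  have := exists_hard_finiteSum.{u} (K := 1) (L := L) (Δ₀ := Δ₀) hn one_pos hε
    (Real.sqrt_nonneg (2 * L * Δ₀)) (by rw [hG2]; linarith)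
    (fun i u => L / 2 * ∑ k, u k ^ 2 - b * u (i, 0))
    (fun i u k => L * u k - if k = (i, 0) then b else 0) ?_ ?_ ?_ ?_ ?_ x0
  · simpa using this
  · intro i u
    have hp : ∀ k, HasFDerivAt (fun v : Fin n × Fin 1 → ℝ => v k)
      (ContinuousLinearMap.proj k : (Fin n × Fin 1 → ℝ) →L[ℝ] ℝ) u := fun k => hasFDerivAt_apply k u
    have h1 := ((HasFDerivAt.fun_sum (u := Finset.univ) fun k _ => (hp k).pow 2).const_mul
      (L / 2)).sub ((hp (i, 0)).const_mul b)
    refine h1.congr_fderiv ?_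
    ext y
    simp [sub_mul, Finset.mul_sum]
    refine Finset.sum_congr rfl fun k _ => ?_
    ring
  · intro u v
    simp only [sub_sub_sub_cancel_right, ← mul_sub, mul_pow]
    rw [← Finset.mul_sum, Finset.sum_const, Finset.card_univ, Fintype.card_fin, nsmul_eq_mul,
      one_div, inv_mul_cancel_left₀ hn'.ne']
  · refine ⟨fun _ => b / (n * L), fun u => ?_, ?_⟩
    · rw [hsum, hsum]
      refine Finset.sum_le_sum fun i _ => ?_
      have h1 : n * L / 2 * u (i, 0) ^ 2 - b * u (i, 0) -
          (n * L / 2 * (b / (n * L)) ^ 2 - b * (b / (n * L))) =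
          n * L / 2 * (u (i, 0) - b / (n * L)) ^ 2 := by
        field_simp
        ring
      have h2 : 0 ≤ n * L / 2 * (u (i, 0) - b / (n * L)) ^ 2 := by positivity
      linarith
    · rw [hsum, hsum]
      simp only [Pi.zero_apply, Finset.sum_const, Finset.card_univ, Fintype.card_fin, nsmul_eq_mul]
      field_simp
      rw [hb2]
      ring
  · intro p u hu j i k hk
    have hki : (i, k) ≠ (j, 0) := by
      rintro h
      rw [Prod.mk.injEq] at h
      rw [if_pos h.1] at hk
      omega
    rw [hu i k (by split_ifs at hk <;> omega), if_neg hki]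
    ring
  · intro S u hu
    rw [hG2, Fintype.sum_prod_type]
    calc 2 * L * Δ₀ / n * S.card = ∑ i ∈ S, 2 * L * Δ₀ / n := by
          rw [Finset.sum_const, nsmul_eq_mul, mul_comm]
      _ ≤ ∑ i ∈ S, (1 / (n : ℝ) *
            ∑ j, (L * u (i, 0) - if (i, (0 : Fin 1)) = (j, 0) then b else 0)) ^ 2 := by
          refine Finset.sum_le_sum fun i hi => ?_
          have h0 : u (i, 0) = 0 := hu i hi
          simp only [h0, Prod.mk.injEq, and_true, mul_zero, zero_sub, Finset.sum_neg_distrib,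
            Finset.sum_ite_eq, Finset.mem_univ, if_true]
          apply le_of_eq
          field_simp
          rw [hb2]
          ring
      _ ≤ _ := by
          simp only [Fin.isValue, Finset.univ_unique, Finset.sum_singleton]
          exact Finset.sum_le_sum_of_subset_of_nonneg (Finset.subset_univ S)
            fun _ _ _ => sq_nonneg _

/-! ### The nonconvex chain -/

lemma hasDerivAt_max_zero_sq (x : ℝ) :
    HasDerivAt (fun x : ℝ => max 0 x ^ 2) (2 * max 0 x) x := by
  rcases lt_trichotomy x 0 with h | rfl | h
  · rw [max_eq_left h.le, mul_zero]
    refine (hasDerivAt_const x (0 : ℝ)).congr_of_eventuallyEq ?_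
    filter_upwards [Iio_mem_nhds h] with y hy
    simp [max_eq_left (Set.mem_Iio.1 hy).le]
  · rw [hasDerivAt_iff_isLittleO_nhds_zero]
    have h1 : (fun h : ℝ => max 0 (0 + h) ^ 2 - max 0 (0 : ℝ) ^ 2 - h • (2 * max 0 (0 : ℝ)))
        =O[nhds 0] fun h => h ^ 2 := by
      refine Asymptotics.isBigO_of_le _ fun h => ?_
      rcases le_total 0 h with h' | h' <;> simp [h']
      positivity
    refine h1.trans_isLittleO ?_
    simpa using Asymptotics.isLittleO_pow_pow (𝕜 := ℝ) (m := 1) (n := 2) (by norm_num)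
  · rw [max_eq_right h.le]
    have h1 : HasDerivAt (fun x : ℝ => x ^ 2) (2 * x) x := by simpa using hasDerivAt_pow 2 x
    refine h1.congr_of_eventuallyEq ?_
    filter_upwards [Ioi_mem_nhds h] with y hy
    rw [max_eq_right (Set.mem_Ioi.1 hy).le]

lemma abs_max_zero_sub_le (x y : ℝ) : |max 0 x - max 0 y| ≤ |x - y| := by
  simpa [max_comm] using abs_max_sub_max_le_abs x y 0

/-- A step from `0` on `(-∞, 0]` to `1` on `[1, ∞)`, piecewise quadratic with Lipschitz
derivative. -/
noncomputable def smoothStep (x : ℝ) : ℝ :=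
  2 * max 0 x ^ 2 - 4 * max 0 (x - 1 / 2) ^ 2 + 2 * max 0 (x - 1) ^ 2

/-- The derivative of `smoothStep`: the tent of height `2` over `[0, 1]`. -/
noncomputable def smoothStepDeriv (x : ℝ) : ℝ :=
  4 * max 0 x - 8 * max 0 (x - 1 / 2) + 4 * max 0 (x - 1)

lemma hasDerivAt_smoothStep (x : ℝ) : HasDerivAt smoothStep (smoothStepDeriv x) x := by
  have h1 := (hasDerivAt_max_zero_sq x).const_mul 2
  have h2 := ((hasDerivAt_max_zero_sq (x - 1 / 2)).comp_sub_const x (1 / 2)).const_mul 4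
  have h3 := ((hasDerivAt_max_zero_sq (x - 1)).comp_sub_const x 1).const_mul 2
  refine ((h1.sub h2).add h3).congr_deriv ?_
  unfold smoothStepDeriv
  ring

lemma smoothStep_of_nonpos {x : ℝ} (h : x ≤ 0) : smoothStep x = 0 := by
  rw [smoothStep, max_eq_left h, max_eq_left (by linarith), max_eq_left (by linarith)]
  norm_num

lemma smoothStep_of_one_le {x : ℝ} (h : 1 ≤ x) : smoothStep x = 1 := by
  rw [smoothStep, max_eq_right (by linarith), max_eq_right (by linarith),
    max_eq_right (by linarith)]
  ring

lemma smoothStep_half : smoothStep (1 / 2) = 1 / 2 := by norm_num [smoothStep]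

lemma smoothStepDeriv_zero : smoothStepDeriv 0 = 0 := by norm_num [smoothStepDeriv]

lemma smoothStepDeriv_nonneg (x : ℝ) : 0 ≤ smoothStepDeriv x := by
  unfold smoothStepDeriv
  rcases max_cases 0 x with h | h <;> rcases max_cases 0 (x - 1 / 2) with h' | h' <;>
    rcases max_cases 0 (x - 1) with h'' | h'' <;> linarith

lemma smoothStepDeriv_le (x : ℝ) : smoothStepDeriv x ≤ 2 := by
  unfold smoothStepDeriv
  rcases max_cases 0 x with h | h <;> rcases max_cases 0 (x - 1 / 2) with h' | h' <;>
    rcases max_cases 0 (x - 1) with h'' | h'' <;> linarith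

lemma one_le_smoothStepDeriv {x : ℝ} (h0 : 1 / 4 ≤ x) (h1 : x ≤ 3 / 4) :
    1 ≤ smoothStepDeriv x := by
  unfold smoothStepDeriv
  rcases max_cases 0 x with h | h <;> rcases max_cases 0 (x - 1 / 2) with h' | h' <;>
    rcases max_cases 0 (x - 1) with h'' | h'' <;> linarith

lemma monotone_smoothStep : Monotone smoothStep :=
  monotone_of_hasDerivAt_nonneg hasDerivAt_smoothStep smoothStepDeriv_nonneg

lemma smoothStep_nonneg (x : ℝ) : 0 ≤ smoothStep x := by
  rcases le_total x 0 with h | h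
  · rw [smoothStep_of_nonpos h]
  · exact (smoothStep_of_nonpos le_rfl).symm.le.trans (monotone_smoothStep h)

lemma smoothStep_le_one (x : ℝ) : smoothStep x ≤ 1 := by
  rcases le_total 1 x with h | h
  · rw [smoothStep_of_one_le h]
  · exact (monotone_smoothStep h).trans (smoothStep_of_one_le le_rfl).le

lemma abs_smoothStepDeriv_sub_le (x y : ℝ) :
    |smoothStepDeriv x - smoothStepDeriv y| ≤ 16 * |x - y| := by
  have h1 := abs_max_zero_sub_le x y
  have h2 := abs_max_zero_sub_le (x - 1 / 2) (y - 1 / 2)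
  have h3 := abs_max_zero_sub_le (x - 1) (y - 1)
  rw [sub_sub_sub_cancel_right] at h2 h3
  unfold smoothStepDeriv
  rw [abs_le] at *
  constructor <;> linarith

lemma abs_smoothStep_sub_le (x y : ℝ) : |smoothStep x - smoothStep y| ≤ 2 * |x - y| := by
  have := Convex.norm_image_sub_le_of_norm_hasDerivWithin_le (f := smoothStep)
    (f' := smoothStepDeriv) (s := Set.univ) (C := 2) (x := y) (y := x)
    (fun z _ => (hasDerivAt_smoothStep z).hasDerivWithinAt)
    (fun z _ => by
      rw [Real.norm_eq_abs, abs_of_nonneg (smoothStepDeriv_nonneg z)]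
      exact smoothStepDeriv_le z) convex_univ trivial trivial
  simpa using this

/-- The step `smoothStep`, stretched to rise on `[-2, 2]`. -/
noncomputable def wideStep (x : ℝ) : ℝ := smoothStep ((x + 2) / 4)

/-- The derivative of `wideStep`. -/
noncomputable def wideStepDeriv (x : ℝ) : ℝ := smoothStepDeriv ((x + 2) / 4) / 4

lemma hasDerivAt_wideStep (x : ℝ) : HasDerivAt wideStep (wideStepDeriv x) x := by
  have h1 : HasDerivAt (fun x : ℝ => (x + 2) / 4) (1 / 4) x :=
    ((hasDerivAt_id x).add_const 2).div_const 4
  refine ((hasDerivAt_smoothStep ((x + 2) / 4)).comp x h1).congr_deriv ?_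
  unfold wideStepDeriv
  ring

lemma wideStepDeriv_nonneg (x : ℝ) : 0 ≤ wideStepDeriv x :=
  div_nonneg (smoothStepDeriv_nonneg _) (by norm_num)

lemma wideStepDeriv_le (x : ℝ) : wideStepDeriv x ≤ 1 / 2 := by
  have := smoothStepDeriv_le ((x + 2) / 4)
  unfold wideStepDeriv
  linarith

lemma abs_wideStepDeriv_sub_le (x y : ℝ) : |wideStepDeriv x - wideStepDeriv y| ≤ |x - y| := by
  have := abs_smoothStepDeriv_sub_le ((x + 2) / 4) ((y + 2) / 4)
  unfold wideStepDeriv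
  rw [← sub_div, abs_div, abs_of_pos (by norm_num : (0 : ℝ) < 4)]
  rw [← sub_div, add_sub_add_right_eq_sub, abs_div, abs_of_pos (by norm_num : (0 : ℝ) < 4)] at this
  linarith

lemma abs_wideStep_sub_le (x y : ℝ) : |wideStep x - wideStep y| ≤ |x - y| := by
  have := abs_smoothStep_sub_le ((x + 2) / 4) ((y + 2) / 4)
  rw [← sub_div, add_sub_add_right_eq_sub, abs_div, abs_of_pos (by norm_num : (0 : ℝ) < 4)] at this
  unfold wideStep
  linarith [abs_nonneg (x - y)]

/-- The derivative of `x ↦ max 0 (-x) ^ 2 / 2 - wideStep x` is at most `-1 / 4` on `(-∞, 1]`: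
for `x ≤ -1` because of the penalty, then because of the step. -/
lemma neg_max_sub_wideStepDeriv_le {x : ℝ} (hx : x ≤ 1) :
    -max 0 (-x) - wideStepDeriv x ≤ -(1 / 4) := by
  rcases le_total x (-1) with h | h
  · have := wideStepDeriv_nonneg x
    have := le_max_right 0 (-x)
    linarith
  · have := one_le_smoothStepDeriv (x := (x + 2) / 4) (by linarith) (by linarith)
    have := le_max_left 0 (-x)
    unfold wideStepDeriv
    linarith

/-- The nonconvex chain of length `m + 1`. A coordinate is worth raising only once its predecessor
is positive, and the penalty keeps the gradient large at negative coordinates. -/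
noncomputable def chainFun {m : ℕ} (v : Fin (m + 1) → ℝ) : ℝ :=
  ∑ k, max 0 (-v k) ^ 2 / 2 - wideStep (v 0) -
    ∑ k : Fin m, smoothStep (v k.castSucc) * wideStep (v k.succ)

/-- The gradient of `chainFun`. -/
noncomputable def chainGrad {m : ℕ} (v : Fin (m + 1) → ℝ) (j : Fin (m + 1)) : ℝ :=
  -max 0 (-v j) -
    Fin.cons (α := fun _ => ℝ) (wideStepDeriv (v 0))
      (fun k : Fin m => smoothStep (v k.castSucc) * wideStepDeriv (v k.succ)) j -
    Fin.snoc (α := fun _ => ℝ)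
      (fun k : Fin m => smoothStepDeriv (v k.castSucc) * wideStep (v k.succ)) 0 j

lemma hasFDerivAt_chainFun {m : ℕ} (v : Fin (m + 1) → ℝ) :
    HasFDerivAt chainFun
      (∑ k, chainGrad v k • (ContinuousLinearMap.proj k : (Fin (m + 1) → ℝ) →L[ℝ] ℝ)) v := by
  have hp : ∀ k, HasFDerivAt (fun v : Fin (m + 1) → ℝ => v k)
      (ContinuousLinearMap.proj k : (Fin (m + 1) → ℝ) →L[ℝ] ℝ) v := fun k => hasFDerivAt_apply k v
  have hP : ∀ x : ℝ, HasDerivAt (fun x : ℝ => max 0 (-x) ^ 2 / 2) (-max 0 (-x)) x := fun x => by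
    refine (((hasDerivAt_max_zero_sq (-x)).comp x (hasDerivAt_neg x)).div_const 2).congr_deriv ?_
    ring
  have h1 := HasFDerivAt.fun_sum (u := Finset.univ) fun k _ =>
    (hP (v k)).comp_hasFDerivAt v (hp k)
  have h2 := (hasDerivAt_wideStep (v 0)).comp_hasFDerivAt v (hp 0)
  have h3 := HasFDerivAt.fun_sum (u := Finset.univ) fun (k : Fin m) _ =>
    ((hasDerivAt_smoothStep (v k.castSucc)).comp_hasFDerivAt v (hp k.castSucc)).mul
      ((hasDerivAt_wideStep (v k.succ)).comp_hasFDerivAt v (hp k.succ))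
  refine ((h1.sub h2).sub h3).congr_fderiv ?_
  ext y
  simp only [chainGrad, sub_mul, Finset.sum_sub_distrib, _root_.sum_apply,
    _root_.smul_apply, _root_.sub_apply, _root_.add_apply,
    ContinuousLinearMap.proj_apply, smul_eq_mul, Function.comp_apply]
  rw [Fin.sum_univ_succ (fun x => Fin.cons (α := fun _ => ℝ) (wideStepDeriv (v 0))
      (fun k : Fin m => smoothStep (v k.castSucc) * wideStepDeriv (v k.succ)) x * y x),
    Fin.sum_univ_castSucc (fun x => Fin.snoc (α := fun _ => ℝ)
      (fun k : Fin m => smoothStepDeriv (v k.castSucc) * wideStep (v k.succ)) 0 x * y x)]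
  simp only [Fin.cons_zero, Fin.cons_succ, Fin.snoc_castSucc, Fin.snoc_last, zero_mul, add_zero,
    Finset.sum_add_distrib]
  have e1 : ∀ k : Fin m, smoothStep (v k.castSucc) * (wideStepDeriv (v k.succ) * y k.succ) =
    smoothStep (v k.castSucc) * wideStepDeriv (v k.succ) * y k.succ := fun k => by ring
  have e2 : ∀ k : Fin m, wideStep (v k.succ) * (smoothStepDeriv (v k.castSucc) * y k.castSucc) =
    smoothStepDeriv (v k.castSucc) * wideStep (v k.succ) * y k.castSucc := fun k => by ring
  simp only [e1, e2]
  ring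

lemma neg_le_chainFun {m : ℕ} (v : Fin (m + 1) → ℝ) : -((m : ℝ) + 1) ≤ chainFun v := by
  have h1 : 0 ≤ ∑ k, max 0 (-v k) ^ 2 / 2 := Finset.sum_nonneg fun k _ => by positivity
  have h2 : wideStep (v 0) ≤ 1 := smoothStep_le_one _
  have h3 : ∑ k : Fin m, smoothStep (v k.castSucc) * wideStep (v k.succ) ≤ m := by
    calc _ ≤ ∑ _ : Fin m, (1 : ℝ) := Finset.sum_le_sum fun k _ =>
          mul_le_one₀ (smoothStep_le_one _) (smoothStep_nonneg _) (smoothStep_le_one _)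
      _ = m := by simp
  unfold chainFun
  linarith

lemma chainFun_two {m : ℕ} : chainFun (fun _ : Fin (m + 1) => (2 : ℝ)) = -((m : ℝ) + 1) := by
  have h1 : smoothStep 2 = 1 := smoothStep_of_one_le (by norm_num)
  have h2 : wideStep 2 = 1 := smoothStep_of_one_le (by norm_num)
  simp [chainFun, h1, h2]
  ring

lemma chainFun_zero {m : ℕ} : chainFun (fun _ : Fin (m + 1) => (0 : ℝ)) = -(1 / 2) := by
  have h1 : smoothStep 0 = 0 := smoothStep_of_nonpos le_rfl
  have h2 : wideStep 0 = 1 / 2 := by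
    rw [← smoothStep_half, wideStep]
    norm_num
  simp [chainFun, h1, h2]

/-- The zero-chain property. -/
lemma chainGrad_eq_zero {m p : ℕ} {v : Fin (m + 1) → ℝ} (hv : ∀ k, p ≤ k.val → v k = 0)
    {j : Fin (m + 1)} (hj : p + 1 ≤ j.val) : chainGrad v j = 0 := by
  have h1 : Fin.cons (α := fun _ => ℝ) (wideStepDeriv (v 0))
      (fun k : Fin m => smoothStep (v k.castSucc) * wideStepDeriv (v k.succ)) j = 0 := by
    cases j using Fin.cases with
    | zero => simp at hj
    | succ k =>
      rw [Fin.cons_succ, hv k.castSucc (by simpa using hj), smoothStep_of_nonpos le_rfl, zero_mul]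
  have h2 : Fin.snoc (α := fun _ => ℝ)
      (fun k : Fin m => smoothStepDeriv (v k.castSucc) * wideStep (v k.succ)) 0 j = 0 := by
    cases j using Fin.lastCases with
    | last => rw [Fin.snoc_last]
    | cast k =>
      rw [Fin.snoc_castSucc, hv k.castSucc (by omega), smoothStepDeriv_zero, zero_mul]
  rw [chainGrad, h1, h2, hv j (by omega)]
  simp

/-- Until the last coordinate is reached, the gradient is large at the first coordinate below
`1`: its predecessor is at least `1`, and all terms of the partial derivative have one sign. -/
lemma sum_chainGrad_sq_ge {m : ℕ} {v : Fin (m + 1) → ℝ} (hv : v (Fin.last m) = 0) :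
    1 / 16 ≤ ∑ k, chainGrad v k ^ 2 := by
  obtain ⟨j, hj, hmin⟩ := exists_minimal_of_wellFoundedLT (fun j => v j < 1)
    ⟨Fin.last m, by simp [hv]⟩
  have hmin' : ∀ i, i < j → 1 ≤ v i := fun i hi => by
    by_contra h
    exact absurd (hmin (not_le.1 h) hi.le) (not_le.2 hi)
  have h1 : Fin.cons (α := fun _ => ℝ) (wideStepDeriv (v 0))
      (fun k : Fin m => smoothStep (v k.castSucc) * wideStepDeriv (v k.succ)) j =
      wideStepDeriv (v j) := by
    cases j using Fin.cases with
    | zero => rw [Fin.cons_zero]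
    | succ k =>
      rw [Fin.cons_succ, smoothStep_of_one_le (hmin' _ (Fin.castSucc_lt_succ)), one_mul]
  have h2 : 0 ≤ Fin.snoc (α := fun _ => ℝ)
      (fun k : Fin m => smoothStepDeriv (v k.castSucc) * wideStep (v k.succ)) 0 j := by
    cases j using Fin.lastCases with
    | last => rw [Fin.snoc_last]
    | cast k =>
      rw [Fin.snoc_castSucc]
      exact mul_nonneg (smoothStepDeriv_nonneg _) (smoothStep_nonneg _)
  have h3 := neg_max_sub_wideStepDeriv_le (le_of_lt hj)
  have h4 : chainGrad v j ≤ -(1 / 4) := by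
    rw [chainGrad, h1]
    linarith
  calc (1 : ℝ) / 16 ≤ chainGrad v j ^ 2 := by nlinarith
    _ ≤ _ := Finset.single_le_sum (f := fun k => chainGrad v k ^ 2)
      (fun k _ => sq_nonneg _) (Finset.mem_univ j)

lemma abs_mul_sub_mul_le {a a' b b' A B C D s t : ℝ} (hb : |b| ≤ B) (ha' : |a'| ≤ A)
    (ha : |a - a'| ≤ C * s) (hbb : |b - b'| ≤ D * t) :
    |a * b - a' * b'| ≤ C * s * B + A * (D * t) := by
  have h : a * b - a' * b' = (a - a') * b + a' * (b - b') := by ring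
  rw [h]
  refine (abs_add_le _ _).trans ?_
  rw [abs_mul, abs_mul]
  have := (abs_nonneg a').trans ha'
  have := (abs_nonneg (a - a')).trans ha
  gcongr

lemma sq_le_of_abs_le_add {x a b : ℝ} (h : |x| ≤ 16 * |a| + 16 * |b|) :
    x ^ 2 ≤ 512 * a ^ 2 + 512 * b ^ 2 := by
  have h1 := pow_le_pow_left₀ (abs_nonneg x) h 2
  rw [sq_abs] at h1
  nlinarith [sq_nonneg (|a| - |b|), sq_abs a, sq_abs b]

/-- The gradient of the chain is `80`-Lipschitz, whatever the length: each partial derivative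
involves only three consecutive coordinates. -/
lemma sum_chainGrad_sub_sq_le {m : ℕ} (v w : Fin (m + 1) → ℝ) :
    ∑ k, (chainGrad v k - chainGrad w k) ^ 2 ≤ 80 ^ 2 * ∑ k, (v k - w k) ^ 2 := by
  let B : (Fin (m + 1) → ℝ) → Fin (m + 1) → ℝ := fun v =>
    Fin.cons (α := fun _ => ℝ) (wideStepDeriv (v 0))
      (fun k : Fin m => smoothStep (v k.castSucc) * wideStepDeriv (v k.succ))
  let C : (Fin (m + 1) → ℝ) → Fin (m + 1) → ℝ := fun v =>
    Fin.snoc (α := fun _ => ℝ)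
      (fun k : Fin m => smoothStepDeriv (v k.castSucc) * wideStep (v k.succ)) 0
  set S := ∑ k, (v k - w k) ^ 2 with hS
  have hSs : S = (v 0 - w 0) ^ 2 + ∑ k : Fin m, (v k.succ - w k.succ) ^ 2 :=
    Fin.sum_univ_succ _
  have hSc : S = ∑ k : Fin m, (v k.castSucc - w k.castSucc) ^ 2 +
      (v (Fin.last m) - w (Fin.last m)) ^ 2 := Fin.sum_univ_castSucc _
  have hlast := sq_nonneg (v (Fin.last m) - w (Fin.last m))
  have hA : ∑ k, (max 0 (-v k) - max 0 (-w k)) ^ 2 ≤ S := Finset.sum_le_sum fun k _ => by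
    rw [sq_le_sq]
    refine (abs_max_zero_sub_le _ _).trans (le_of_eq ?_)
    rw [← abs_neg]
    congr 1
    ring
  have hB : ∑ k, (B v k - B w k) ^ 2 ≤ 1024 * S := by
    have h1 : (wideStepDeriv (v 0) - wideStepDeriv (w 0)) ^ 2 ≤ (v 0 - w 0) ^ 2 :=
      sq_le_sq.2 (abs_wideStepDeriv_sub_le _ _)
    have h2 : ∀ k : Fin m, (smoothStep (v k.castSucc) * wideStepDeriv (v k.succ) -
        smoothStep (w k.castSucc) * wideStepDeriv (w k.succ)) ^ 2 ≤
        512 * (v k.castSucc - w k.castSucc) ^ 2 + 512 * (v k.succ - w k.succ) ^ 2 := fun k => by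
      apply sq_le_of_abs_le_add
      refine (abs_mul_sub_mul_le (A := 1) (B := 1 / 2) (D := 1) ?_ ?_
        (abs_smoothStep_sub_le _ _) ((abs_wideStepDeriv_sub_le _ _).trans (one_mul _).ge)).trans ?_
      · rw [abs_of_nonneg (wideStepDeriv_nonneg _)]
        exact wideStepDeriv_le _
      · rw [abs_of_nonneg (smoothStep_nonneg _)]
        exact smoothStep_le_one _
      · linarith [abs_nonneg (v k.castSucc - w k.castSucc), abs_nonneg (v k.succ - w k.succ)]
    have h3 := Finset.sum_le_sum fun k (_ : k ∈ Finset.univ) => h2 k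
    rw [Finset.sum_add_distrib, ← Finset.mul_sum, ← Finset.mul_sum] at h3
    rw [Fin.sum_univ_succ]
    simp only [B, Fin.cons_zero, Fin.cons_succ]
    nlinarith [sq_nonneg (v 0 - w 0)]
  have hC : ∑ k, (C v k - C w k) ^ 2 ≤ 1024 * S := by
    have h2 : ∀ k : Fin m, (smoothStepDeriv (v k.castSucc) * wideStep (v k.succ) -
        smoothStepDeriv (w k.castSucc) * wideStep (w k.succ)) ^ 2 ≤
        512 * (v k.castSucc - w k.castSucc) ^ 2 + 512 * (v k.succ - w k.succ) ^ 2 := fun k => by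
      apply sq_le_of_abs_le_add
      refine (abs_mul_sub_mul_le (A := 2) (B := 1) (D := 1) ?_ ?_
        (abs_smoothStepDeriv_sub_le _ _) ((abs_wideStep_sub_le _ _).trans (one_mul _).ge)).trans ?_
      · rw [wideStep, abs_of_nonneg (smoothStep_nonneg _)]
        exact smoothStep_le_one _
      · rw [abs_of_nonneg (smoothStepDeriv_nonneg _)]
        exact smoothStepDeriv_le _
      · linarith [abs_nonneg (v k.castSucc - w k.castSucc), abs_nonneg (v k.succ - w k.succ)]
    have h3 := Finset.sum_le_sum fun k (_ : k ∈ Finset.univ) => h2 k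
    rw [Finset.sum_add_distrib, ← Finset.mul_sum, ← Finset.mul_sum] at h3
    rw [Fin.sum_univ_castSucc]
    simp only [C, Fin.snoc_castSucc, Fin.snoc_last]
    nlinarith
  have hABC : ∀ k, (chainGrad v k - chainGrad w k) ^ 2 ≤
      3 * (max 0 (-v k) - max 0 (-w k)) ^ 2 + 3 * (B v k - B w k) ^ 2 +
        3 * (C v k - C w k) ^ 2 := fun k => by
    have h : chainGrad v k - chainGrad w k =
        -(max 0 (-v k) - max 0 (-w k)) - (B v k - B w k) - (C v k - C w k) := by
      simp only [chainGrad, B, C]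
      ring
    rw [h]
    generalize max 0 (-v k) - max 0 (-w k) = a
    generalize B v k - B w k = b
    generalize C v k - C w k = c
    nlinarith [sq_nonneg (a - b), sq_nonneg (a - c), sq_nonneg (b - c)]
  have hsum := Finset.sum_le_sum fun k (_ : k ∈ Finset.univ) => hABC k
  rw [Finset.sum_add_distrib, Finset.sum_add_distrib, ← Finset.mul_sum, ← Finset.mul_sum,
    ← Finset.mul_sum] at hsum
  have hS0 : 0 ≤ S := Finset.sum_nonneg fun k _ => sq_nonneg _
  linarith

/-- Disjoint copies of the chain of length `m + 1`, one per component, rescaled so that the average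
smoothness constant is `L` and the optimality gap is `Δ₀`. -/
theorem hasHardFiniteSum_chain {n m : ℕ} (hn : 0 < n) {L Δ₀ ε : ℝ} (hL : 0 < L) (hΔ : 0 < Δ₀)
    (hε : 0 < ε) (hm : ((m : ℝ) + 1) * (2560 * Real.sqrt n * ε ^ 2) ≤ Δ₀ * L)
    (x0 : EuclideanSpace ℝ (Fin (n * (m + 1) + 1))) :
    HasHardFiniteSum.{u} n (n * (m + 1) + 1) L Δ₀ ε (n * (m + 1) / 4) x0 := by
  have hn' : (0 : ℝ) < n := by exact_mod_cast hn
  set r := Real.sqrt n with hr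
  have hr0 : 0 < r := Real.sqrt_pos.2 hn'
  have hr2 : r ^ 2 = n := Real.sq_sqrt hn'.le
  -- `l` is the scale of the values and `β` that of the arguments
  set l := Δ₀ / (m + 1 / 2) with hl
  have hl0 : 0 < l := by positivity
  set β := Real.sqrt (r * L / (80 * l)) with hβ
  have hβ0 : 0 < β := Real.sqrt_pos.2 (by positivity)
  have hβ2 : β ^ 2 = r * L / (80 * l) := Real.sq_sqrt (by positivity)
  set G := l * β / (4 * r) with hG
  have hG2 : G ^ 2 = l * L / (1280 * r) := by
    rw [hG, div_pow, mul_pow, hβ2]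
    field_simp
    norm_num
  have hGε : 2 * ε ^ 2 ≤ G ^ 2 := by
    rw [hG2, hl, div_mul_eq_mul_div, div_div, le_div_iff₀ (by positivity)]
    nlinarith [mul_pos hr0 (pow_pos hε 2)]
  have hblock : ∀ u v : Fin n × Fin (m + 1) → ℝ, ∀ i,
      ∑ k, (l * β * chainGrad (fun k => β * u (i, k)) k -
        l * β * chainGrad (fun k => β * v (i, k)) k) ^ 2 ≤
        n * L ^ 2 * ∑ k, (u (i, k) - v (i, k)) ^ 2 := by
    intro u v i
    have h := sum_chainGrad_sub_sq_le (fun k => β * u (i, k)) (fun k => β * v (i, k))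
    simp only [← mul_sub, mul_pow, ← Finset.mul_sum] at h ⊢
    refine (mul_le_mul_of_nonneg_left h (by positivity : 0 ≤ l ^ 2 * β ^ 2)).trans (le_of_eq ?_)
    rw [hβ2, ← hr2]
    field_simp
  have := exists_hard_finiteSum.{u} (K := m + 1) (L := L) (Δ₀ := Δ₀) hn m.succ_pos hε
    (by positivity : 0 ≤ G) hGε
    (fun i u => l * chainFun fun k => β * u (i, k))
    (fun i u k => if k.1 = i then l * β * chainGrad (fun k => β * u (i, k)) k.2 else 0)
    ?_ ?_ ?_ ?_ ?_ x0
  · simpa using this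
  · intro i u
    let Λ : (Fin n × Fin (m + 1) → ℝ) →L[ℝ] (Fin (m + 1) → ℝ) :=
      ContinuousLinearMap.pi fun k => β • ContinuousLinearMap.proj (i, k)
    have h1 := ((hasFDerivAt_chainFun (Λ u)).comp u Λ.hasFDerivAt).const_mul l
    refine h1.congr_fderiv ?_
    ext y
    have hΛ : ∀ y, Λ y = fun k => β * y (i, k) := fun y => rfl
    simp only [hΛ, _root_.sum_apply, _root_.smul_apply, ContinuousLinearMap.comp_apply,
      ContinuousLinearMap.proj_apply, smul_eq_mul, Fintype.sum_prod_type]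
    rw [Finset.sum_eq_single i (fun j _ hj => by simp [hj]) (fun h => absurd (Finset.mem_univ i) h),
      Finset.mul_sum]
    refine Finset.sum_congr rfl fun k _ => ?_
    rw [if_pos rfl]
    ring
  · intro u v
    have h1 : ∀ i, ∑ k : Fin n × Fin (m + 1),
        ((if k.1 = i then l * β * chainGrad (fun k => β * u (i, k)) k.2 else 0) -
          if k.1 = i then l * β * chainGrad (fun k => β * v (i, k)) k.2 else 0) ^ 2 =
        ∑ k, (l * β * chainGrad (fun k => β * u (i, k)) k -
          l * β * chainGrad (fun k => β * v (i, k)) k) ^ 2 := fun i => by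
      rw [Fintype.sum_prod_type, Finset.sum_eq_single i (fun j _ hj => by simp [hj])
        (fun h => absurd (Finset.mem_univ i) h)]
      simp
    simp_rw [h1]
    have h2 := Finset.sum_le_sum fun i (_ : i ∈ Finset.univ) => hblock u v i
    rw [← Finset.mul_sum] at h2
    rw [Fintype.sum_prod_type, one_div, inv_mul_le_iff₀ hn']
    linarith
  · refine ⟨fun _ => 2 / β, fun u => ?_, ?_⟩
    · refine Finset.sum_le_sum fun i _ => ?_
      simp only [mul_div_cancel₀ _ hβ0.ne', chainFun_two]
      exact mul_le_mul_of_nonneg_left (neg_le_chainFun _) hl0.le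
    · simp only [mul_div_cancel₀ _ hβ0.ne', chainFun_two, Pi.zero_apply, mul_zero, chainFun_zero,
        Finset.sum_const, Finset.card_univ, Fintype.card_fin, nsmul_eq_mul]
      rw [hl]
      field_simp
      ring
  · intro p u hu j i k hk
    split_ifs with h
    · subst h
      rw [if_pos rfl] at hk
      rw [chainGrad_eq_zero (fun k hk => by rw [hu _ k hk, mul_zero]) hk, mul_zero]
    · rfl
  · intro S u hu
    simp only [Finset.sum_ite_eq, Finset.mem_univ, if_true]
    rw [Fintype.sum_prod_type]
    calc G ^ 2 / n * S.card = ∑ i ∈ S, G ^ 2 / n := by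
          rw [Finset.sum_const, nsmul_eq_mul, mul_comm]
      _ ≤ ∑ i ∈ S, ∑ k, (1 / (n : ℝ) *
            (l * β * chainGrad (fun k => β * u (i, k)) k)) ^ 2 := by
          refine Finset.sum_le_sum fun i hi => ?_
          have h0 : β * u (i, Fin.last m) = 0 := by
            rw [show u (i, Fin.last m) = 0 from hu i hi, mul_zero]
          have h1 := sum_chainGrad_sq_ge (v := fun k => β * u (i, k)) h0
          simp only [mul_pow, ← Finset.mul_sum, ← mul_assoc]
          refine le_trans (le_of_eq ?_) (mul_le_mul_of_nonneg_left h1 (by positivity))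
          rw [hG, div_pow, mul_pow, mul_pow, hr2]
          field_simp
          norm_num
      _ ≤ _ := Finset.sum_le_sum_of_subset_of_nonneg (Finset.subset_univ S)
            fun _ _ _ => Finset.sum_nonneg fun _ _ => sq_nonneg _

/-! ### The complexity lower bound -/

theorem theorem2 :
    ∃ c : ℝ, 0 < c ∧
      ∀ (L Δ₀ ε : ℝ) (n : ℕ), 0 < L → 0 < Δ₀ → 0 < n → 0 < ε → ε ≤ Real.sqrt (Δ₀ * L) →
        ∃ d : ℕ, ∀ x0 : EuclideanSpace ℝ (Fin d),
          ∃ f : Fin n → EuclideanSpace ℝ (Fin d) → ℝ,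
            (∀ i, Differentiable ℝ (f i)) ∧
            AverageSmooth L f ∧
            (∃ xstar, (∀ x, finiteSum f xstar ≤ finiteSum f x) ∧
              finiteSum f x0 - finiteSum f xstar = Δ₀) ∧
            ∀ (Ω : Type u) [MeasurableSpace Ω] (μ : Measure Ω) [IsProbabilityMeasure μ]
              (A : LinearSpanRun f x0 μ),
              ∫⁻ ω, ‖gradient (finiteSum f) (A.output ω)‖ₑ ∂μ ≤ ENNReal.ofReal ε →
              ENNReal.ofReal (c * ((n : ℝ) + Δ₀ * L * Real.sqrt n / ε ^ 2)) ≤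
                ∫⁻ ω, (A.count ω : ℝ≥0∞) ∂μ := by
  refine ⟨1 / 30000, by norm_num, fun L Δ₀ ε n hL hΔ hn hε hεΔ => ?_⟩
  have hn' : (0 : ℝ) < n := by exact_mod_cast hn
  have hr0 : 0 < Real.sqrt n := Real.sqrt_pos.2 hn'
  have hr2 : Real.sqrt n ^ 2 = n := Real.sq_sqrt hn'.le
  have hεΔ' : ε ^ 2 ≤ Δ₀ * L := by
    have := pow_le_pow_left₀ hε.le hεΔ 2
    rwa [Real.sq_sqrt (by positivity)] at this
  -- for chains of length at most `R`, the `G` of `hasHardFiniteSum_chain` is at least `√2 ε`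
  set R := Δ₀ * L / (2560 * Real.sqrt n * ε ^ 2) with hR
  have hX : Δ₀ * L * Real.sqrt n / ε ^ 2 = 2560 * (n * R) := by
    rw [hR]
    field_simp
    rw [hr2]
  rw [hX]
  rcases lt_or_ge R 1 with h | h
  · refine ⟨n * 1 + 1, fun x0 =>
      (hasHardFiniteSum_quadratic hn hL hΔ hε hεΔ' x0).mono ?_⟩
    have : (n : ℝ) * R ≤ n := mul_le_of_le_one_right hn'.le h.le
    linarith
  · obtain ⟨m, hm⟩ := Nat.exists_eq_succ_of_ne_zero (Nat.floor_pos.2 h).ne'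
    have h1 : (m : ℝ) + 1 ≤ R := by
      have := Nat.floor_le (zero_le_one.trans h)
      rw [hm] at this
      exact_mod_cast this
    have h2 : R < m + 2 := by
      have := Nat.lt_floor_add_one R
      rw [hm] at this
      push_cast at this
      linarith
    refine ⟨n * (m + 1) + 1, fun x0 =>
      (hasHardFiniteSum_chain hn hL hΔ hε ?_ x0).mono ?_⟩
    · rwa [hR, le_div_iff₀ (by positivity)] at h1
    · have h3 : R ≤ 2 * (m + 1) := by
        have : (0 : ℝ) ≤ m := m.cast_nonneg
        linarith
      have h4 : (n : ℝ) * R ≤ n * (2 * (m + 1)) := by gcongr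
      have h5 : (n : ℝ) ≤ n * R := le_mul_of_one_le_right hn'.le h
      linarith
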